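/- Terminology. A family $\mathcal A$ of sets is a $(\lambda,\kappa,\mu)$-system if $|\mathcal A|=\lambda$, $|A|=\kappa$ for all $A\in\mathcal A$, and $|A\cap A'|<\mu$ for all distinct $A,A'\in\mathcal A$. For a function $f$ and a set $A$ let $I_f(A)=\{\xi\in\operatorname{ran}(f): |A\cap f^{-1}\{\xi\}|=1\}$. The relation $[\lambda,\kappa,\mu]\Rightarrow\rho$ means that for every $(\lambda,\kappa,\mu)$-system $\mathcal A$ there is a function $f:\bigcup\mathcal A\to\rho$ such that $|\rho\setminus I_f(A)|<\rho$ for all $A\in\mathcal A$. The conflict free chromatic number $\chi_{\rm CF}(\mathcal A)$ is the least cardinal $\rho$ for which there is $f:\bigcup\mathcal A\to\rho$ such that for each $A\in\mathcal A$ some $\zeta<\rho$ satisfies $|A\cap f^{-1}\{\zeta\}|=1$, and $\chi_{\rm CF}(\lambda,\kappa,\mu)=\sup\{\chi_{\rm CF}(\mathcal A):\mathcal A\text{ is a }(\lambda,\kappa,\mu)\text{-system}\}$. For an infinite cardinal $\mu$, $\square_\mu$ is Jensen's principle: there is a sequence $\langle C_\alpha:\alpha<\mu^+\text{ a limit ordinal}\rangle$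 such that each $C_\alpha$ is closed and unbounded in $\alpha$, $C_\beta=C_\alpha\cap\beta$ for every limit point $\beta<\alpha$ of $C_\alpha$, and $C_\alpha$ has order type less than $\mu$ whenever $\operatorname{cf}(\alpha)<\mu$. Theorem. Let $\lambda$ be an uncountable cardinal and assume that (i) $\mu^\omega=\mu^+$ for each cardinal $\mu<\lambda$ with $\operatorname{cf}(\mu)=\omega$, and (ii) $\square_\mu$ holds for each singular cardinal $\mu<\lambda$ with $\operatorname{cf}(\mu)=\omega$. Then $[\lambda,\kappa,\omega]\Rightarrow\omega_1$ holds, and hence $\chi_{\rm CF}(\lambda,\kappa,\omega)\le\omega_1$, for every cardinal $\kappa$ with $\omega_1\le\kappa\le\lambda$. -/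

import Mathlib

open Cardinal Ordinal Set

universe u

namespace ConflictFree

/-- `𝒜` is a `(lam, κ, μ)`-system: `|𝒜| = lam`, every member has size `κ`, and distinct members
meet in fewer than `μ` points. -/
structure IsSystem (lam κ μ : Cardinal.{u}) {X : Type u} (𝒜 : Set (Set X)) : Prop where
  card_eq : #𝒜 = lam
  card_mem : ∀ A ∈ 𝒜, #A = κ
  almostDisjoint : ∀ A ∈ 𝒜, ∀ B ∈ 𝒜, A ≠ B → #(A ∩ B : Set X) < μ

/-- `I_f(A)`: the set of values `ξ ∈ ran f` such that exactly one point of `A` (in the domain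
`S` of `f`) has colour `ξ`. -/
def uniqueColors {X C : Type u} {S : Set X} (f : S → C) (A : Set X) : Set C :=
  {ξ | ξ ∈ range f ∧ #(A ∩ (↑) '' (f ⁻¹' {ξ}) : Set X) = 1}

/-- `f : ⋃ 𝒜 → C` is a conflict free colouring of `𝒜`: every member of `𝒜` has a colour which it
takes exactly once. -/
def IsConflictFree {X C : Type u} (𝒜 : Set (Set X)) (f : ⋃₀ 𝒜 → C) : Prop :=
  ∀ A ∈ 𝒜, ∃ ξ : C, #(A ∩ (↑) '' (f ⁻¹' {ξ}) : Set X) = 1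

/-- The conflict free chromatic number of `𝒜`: the least cardinal `ρ` for which there is a
conflict free colouring `f : ⋃ 𝒜 → ρ`. The type `ρ.ord.ToType` is the cardinal `ρ` seen as a
set of ordinals. (If all members of `𝒜` are nonempty then such a `ρ` exists, see
`exists_isConflictFree`.) -/
noncomputable def chiCF {X : Type u} (𝒜 : Set (Set X)) : Cardinal.{u} :=
  sInf {ρ | ∃ f : ⋃₀ 𝒜 → ρ.ord.ToType, IsConflictFree 𝒜 f}

/-- The conflict free chromatic numbers of all `(lam, κ, μ)`-systems. -/
def chiCFValues (lam κ μ : Cardinal.{u}) : Set Cardinal.{u} :=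
  {c | ∃ (X : Type u) (𝒜 : Set (Set X)), IsSystem lam κ μ 𝒜 ∧ c = chiCF 𝒜}

/-- `χ_CF(lam, κ, μ)`, the supremum of `χ_CF(𝒜)` over all `(lam, κ, μ)`-systems `𝒜`. (This is
a supremum of a bounded set, see `bddAbove_chiCFValues`.) -/
noncomputable def chiCFSup (lam κ μ : Cardinal.{u}) : Cardinal.{u} :=
  sSup (chiCFValues lam κ μ)

/-- The relation `[lam, κ, μ] ⇒ ρ`: every `(lam, κ, μ)`-system `𝒜` has a colouring
`f : ⋃ 𝒜 → ρ` such that `|ρ \ I_f(A)| < ρ` for all `A ∈ 𝒜`. -/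
def DoubleArrow (lam κ μ ρ : Cardinal.{u}) : Prop :=
  ∀ (X : Type u) (𝒜 : Set (Set X)), IsSystem lam κ μ 𝒜 →
    ∃ f : ⋃₀ 𝒜 → ρ.ord.ToType, ∀ A ∈ 𝒜, #((uniqueColors f A)ᶜ : Set ρ.ord.ToType) < ρ

/-- `β` is a limit point of the set `S` of ordinals, i.e. `0 < β = sup (S ∩ β)`. -/
def IsLimitPoint (S : Set Ordinal.{u}) (β : Ordinal.{u}) : Prop :=
  0 < β ∧ ∀ γ < β, ∃ δ ∈ S, γ < δ ∧ δ < β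

/-- `C` is a closed unbounded subset of the limit ordinal `α`. -/
structure IsClubIn (C : Set Ordinal.{u}) (α : Ordinal.{u}) : Prop where
  subset : C ⊆ Iio α
  unbounded : ∀ β < α, ∃ γ ∈ C, β < γ
  closed : ∀ β < α, IsLimitPoint C β → β ∈ C

/-- Jensen's square principle `□_μ`: there are sets `C α`, for limit ordinals `α < μ⁺`, such that
`C α` is a closed unbounded subset of `α`, `C β = C α ∩ β` for every limit point `β < α` of
`C α`, and `C α` has order type less than `μ` whenever `cf α < μ`. -/
def Square (μ : Cardinal.{u}) : Prop :=
  ∃ C : Ordinal.{u} → Set Ordinal.{u},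
    ∀ α : Ordinal.{u}, Order.IsSuccLimit α → α < (Order.succ μ).ord →
      IsClubIn (C α) α ∧
      (∀ β < α, IsLimitPoint (C α) β → C β = C α ∩ Iio β) ∧
      (α.cof < μ → typeLT (C α) < Ordinal.lift.{u + 1} μ.ord)

theorem exists_isConflictFree {X : Type u} {𝒜 : Set (Set X)} (h : ∀ A ∈ 𝒜, A.Nonempty) :
    ∃ f : ⋃₀ 𝒜 → (#(⋃₀ 𝒜)).ord.ToType, IsConflictFree 𝒜 f := by
  obtain ⟨e⟩ := Cardinal.eq.1 (mk_ord_toType #(⋃₀ 𝒜))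
  refine ⟨e.symm, fun A hA ↦ ?_⟩
  obtain ⟨x, hx⟩ := h A hA
  refine ⟨e.symm ⟨x, A, hA, hx⟩, mk_set_eq_one_iff.2 ⟨x, ?_⟩⟩
  ext y
  simp only [mem_inter_iff, mem_image, mem_preimage, mem_singleton_iff, e.symm.injective.eq_iff]
  constructor
  · rintro ⟨-, z, rfl, rfl⟩
    rfl
  · rintro rfl
    exact ⟨hx, _, rfl, rfl⟩

theorem bddAbove_chiCFValues {lam κ : Cardinal.{u}} (μ : Cardinal.{u}) (hlam : ℵ₀ ≤ lam)
    (hκ : κ ≠ 0) (hκlam : κ ≤ lam) : BddAbove (chiCFValues lam κ μ) := by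
  refine ⟨lam, ?_⟩
  rintro _ ⟨X, 𝒜, h, rfl⟩
  have hne : ∀ A ∈ 𝒜, A.Nonempty := fun A hA ↦ by
    rw [nonempty_iff_ne_empty]
    rintro rfl
    exact hκ (by simpa using (h.card_mem _ hA).symm)
  have h₁ : chiCF 𝒜 ≤ #(⋃₀ 𝒜) := csInf_le' (exists_isConflictFree hne)
  refine h₁.trans ?_
  refine (mk_sUnion_le 𝒜).trans ?_
  rw [h.card_eq]
  refine (mul_le_mul' le_rfl (ciSup_le' fun s ↦ ?_)).trans (mul_eq_self hlam).le
  exact (h.card_mem _ s.2).trans_le hκlam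

end ConflictFree

universe v

namespace ConflictFree

/-! Induction on `lam`, starting from a direct construction at `ℵ₁`. For larger `lam`, sets and
points together are ranked by ordinals below `lam.ord`, so that each initial segment has size less
than `lam` and is a union of countably many closed pieces. Closed means: a set of the family meeting
the points of the piece infinitely often belongs to the piece. Hence a set of rank `α` has only
countably many points of rank below `α`. The sets of rank `α` are traced on the points of rank `α`
outside all earlier sets; these traces are coloured by the induction hypothesis
(`allColorable_of_scheme`), and the colourings are glued at the cost of countably many colours per
set (`hasColoring_of_rank`).

Closed pieces are affordable because `μ ^ ℵ₀ = μ⁺` at `μ = ℵ₀` gives CH: a countable set of points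
has only `ℵ₁` infinite traces, and almost disjointness makes these traces distinct. The ranking
(`IsScheme.exists_ranking`) is easy if `x ^ ℵ₀ < lam` for all `x < lam`. Otherwise `lam = μ⁺` with
`μ` singular of countable cofinality. Then a segment of size `μ` must be split into pieces of sizes
`m n` increasing to `μ`, and the coherence of a square sequence keeps these pieces closed at stages
of uncountable cofinality. -/

/-! ### Closures under operations of countable arity, and cardinality bounds. -/

/-- `N` is closed under the set-valued operation `F` of countable arity. -/
def SeqClosed {Y : Type u} (F : (ℕ → Y) → Set Y) (N : Set Y) : Prop :=
  ∀ g : ℕ → Y, (∀ k, g k ∈ N) → F g ⊆ N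

/-- The least `F`-closed set containing `S`. -/
def seqClosure {Y : Type u} (F : (ℕ → Y) → Set Y) (S : Set Y) : Set Y :=
  ⋂₀ {N | S ⊆ N ∧ SeqClosed F N}

theorem subset_seqClosure {Y : Type u} (F : (ℕ → Y) → Set Y) (S : Set Y) :
    S ⊆ seqClosure F S :=
  subset_sInter fun _ h ↦ h.1

theorem seqClosed_seqClosure {Y : Type u} (F : (ℕ → Y) → Set Y) (S : Set Y) :
    SeqClosed F (seqClosure F S) :=
  fun g hg ↦ subset_sInter fun N h ↦ h.2 g fun k ↦ hg k N h

theorem SeqClosed.anti {Y : Type u} {F G : (ℕ → Y) → Set Y} (h : ∀ g, F g ⊆ G g) {N : Set Y}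
    (hN : SeqClosed G N) : SeqClosed F N :=
  fun g hg ↦ (h g).trans (hN g hg)

theorem seqClosure_mono {Y : Type u} {F G : (ℕ → Y) → Set Y} (h : ∀ g, F g ⊆ G g)
    {S T : Set Y} (hST : S ⊆ T) : seqClosure F S ⊆ seqClosure G T :=
  sInter_subset_of_mem ⟨hST.trans (subset_seqClosure G T), (seqClosed_seqClosure G T).anti h⟩

/-- Every element of the closure is the value of a well-founded tree with leaves in `S` and
countably branching nodes labelled by `τ`. The equation `τ ^ ℵ₀ = τ` leaves at most `τ` such trees.
-/
theorem mk_seqClosure_le {Y : Type u} {F : (ℕ → Y) → Set Y} {S : Set Y} {τ : Cardinal.{u}}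
    (h0 : ℵ₀ ≤ τ) (hτ : τ ^ (ℵ₀ : Cardinal.{u}) ≤ τ) (hF : ∀ g, #(F g) ≤ τ) (hS : #S ≤ τ) :
    #(seqClosure F S) ≤ τ := by
  have hj : ∀ g, Nonempty (F g ↪ τ.out) := fun g ↦ by
    rw [← Cardinal.le_def, Cardinal.mk_out]
    exact hF g
  let j := fun g ↦ (hj g).some
  -- `e g` lists `F g` by labels from `τ`; spare labels return the harmless value `g 0`.
  let e : (ℕ → Y) → τ.out → Y := fun g ↦ Function.extend (j g) Subtype.val (fun _ ↦ g 0)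
  let β : S ⊕ τ.out → Type u := fun a ↦ Sum.elim (fun _ ↦ PEmpty) (fun _ ↦ ULift ℕ) a
  let fγ : (Σ a, β a → Y) → Y := fun p ↦ match p with
    | ⟨Sum.inl s, _⟩ => s
    | ⟨Sum.inr t, f⟩ => e (fun k ↦ f (ULift.up k)) t
  have hN : seqClosure F S ⊆ range (WType.elim (β := β) Y fγ) := by
    refine sInter_subset_of_mem ⟨fun s hs ↦ ⟨WType.mk (Sum.inl ⟨s, hs⟩) PEmpty.elim, rfl⟩, ?_⟩
    intro g hg y hy
    choose w hw using hg
    refine ⟨WType.mk (Sum.inr (j g ⟨y, hy⟩)) (fun k : ULift ℕ ↦ w k.down), ?_⟩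
    change e (fun k ↦ WType.elim (β := β) Y fγ (w k)) _ = y
    simp only [hw]
    exact (j g).injective.extend_apply _ _ ⟨y, hy⟩
  refine (mk_le_mk_of_subset hN).trans (mk_range_le.trans ?_)
  refine WType.cardinalMk_le_of_le ?_
  have hterm : ∀ a, τ ^ #(β a) ≤ τ := by
    rintro (s | t)
    · simpa [β] using one_le_aleph0.trans h0
    · simpa [β] using hτ
  refine (sum_le_sum _ (fun _ ↦ τ) hterm).trans ?_
  rw [sum_const', mk_sum, Cardinal.lift_id, Cardinal.lift_id, Cardinal.mk_out]
  calc (#S + τ) * τ ≤ (τ + τ) * τ := by gcongr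
    _ = τ := by rw [add_eq_self h0, mul_eq_self h0]

theorem exists_injective_ordinal {S : Type u} {c : Cardinal.{u}} (h : #S ≤ c) :
    ∃ o : S → Ordinal.{u}, Function.Injective o ∧ ∀ s, o s < c.ord := by
  rw [← mk_ord_toType c] at h
  obtain ⟨j⟩ := h
  exact ⟨fun s ↦ (j s).toOrd, fun a b h ↦ j.injective (ToType.mk.symm.injective (Subtype.ext h)),
    fun s ↦ (j s).toOrd.2⟩

theorem mk_le_of_injective_ordinal {S : Type u} {c : Cardinal.{u}} {o : S → Ordinal.{u}}
    (ho : Function.Injective o) (h : ∀ s, o s < c.ord) : #S ≤ c := by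
  rw [← mk_ord_toType c]
  exact mk_le_of_injective (f := fun s ↦ ToType.mk ⟨o s, h s⟩)
    fun a b hab ↦ ho (congrArg Subtype.val (ToType.mk.injective hab))

/-- A set of size at most a supremum of an increasing sequence of cardinals is an increasing union
of sets whose sizes are bounded by the terms of the sequence. -/
theorem exists_iUnion_eq_mk_le {X : Type u} (S : Set X) (σ : ℕ → Cardinal.{u})
    (hσ : Monotone σ) (hS : #S ≤ ⨆ n, σ n) :
    ∃ R : ℕ → Set X, Monotone R ∧ (∀ n, #(R n) ≤ σ n) ∧ ⋃ n, R n = S := by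
  obtain ⟨o, ho, hlt⟩ := exists_injective_ordinal hS
  refine ⟨fun n ↦ (↑) '' {s : S | o s < (σ n).ord}, ?_, ?_, ?_⟩
  · intro m n hmn
    exact image_mono fun s (hs : o s < _) ↦ hs.trans_le (ord_le_ord.2 (hσ hmn))
  · intro n
    refine mk_image_le.trans (mk_le_of_injective_ordinal (o := fun s ↦ o s.1) ?_ fun s ↦ s.2)
    exact fun a b h ↦ Subtype.ext (ho h)
  · ext x
    simp only [mem_iUnion, mem_image, mem_ofPred_eq, Subtype.exists, exists_and_right, exists_eq_right]
    constructor
    · rintro ⟨_, h, -⟩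
      exact h
    · intro hx
      have h1 : o ⟨x, hx⟩ < (⨆ n, σ n).ord := hlt _
      rw [lt_ord] at h1
      obtain ⟨n, hn⟩ := exists_lt_of_lt_ciSup h1
      exact ⟨n, hx, lt_ord.2 hn⟩

theorem mk_iUnion_le_of_le {ι : Type v} {X : Type u} {c : Cardinal.{u}} (hc : ℵ₀ ≤ c)
    (hι : Cardinal.lift.{u} #ι ≤ Cardinal.lift.{v} c) (s : ι → Set X) (hs : ∀ i, #(s i) ≤ c) :
    #(⋃ i, s i) ≤ c := by
  rw [← Cardinal.lift_le.{v}]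
  calc Cardinal.lift.{v} #(⋃ i, s i)
      ≤ Cardinal.lift.{u} #ι * ⨆ i, Cardinal.lift.{v} #(s i) := mk_iUnion_le_lift s
    _ ≤ Cardinal.lift.{v} c * Cardinal.lift.{v} c := by
        gcongr
        exact ciSup_le' fun i ↦ Cardinal.lift_le.2 (hs i)
    _ = Cardinal.lift.{v} c := mul_eq_self (aleph0_le_lift.2 hc)

/-! ### Ranking a set along a scheme. -/

theorem exists_ordinal_recursion {Y : Type u} (D : Ordinal.{u} → Set Ordinal.{u})
    (hD : ∀ α, D α ⊆ Iio α) (c : Ordinal.{u} → ℕ → Prop)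
    (G : Ordinal.{u} → (ℕ → Set Y) → ℕ → Set Y) :
    ∃ M K : Ordinal.{u} → ℕ → Set Y,
      (∀ α n y, y ∈ M α n ↔ c α n ∧ ∃ β ∈ D α, y ∈ K β n) ∧ ∀ α, K α = G α (M α) := by
  let R (α : Ordinal.{u}) (rec : ∀ β, β < α → ℕ → Set Y) (n : ℕ) : Set Y :=
    {y | c α n ∧ ∃ β, ∃ h : β ∈ D α, y ∈ rec β (hD α h) n}
  let K : Ordinal.{u} → ℕ → Set Y := Ordinal.lt_wf.fix fun α rec ↦ G α (R α rec)
  refine ⟨fun α ↦ R α fun β _ ↦ K β, K, fun α n y ↦ ?_, fun α ↦ Ordinal.lt_wf.fix_eq _ α⟩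
  simp [R]

/-- Conditions under which a set of size `lam` is the union of a chain, of length `lam.ord`, of sets
`M α`, where `M α` is the union over `n` of sets `M α n` of size `σ α n`, and `M α n` is assembled
from the sets `M β n` with `β ∈ D α`. -/
structure IsScheme (lam : Cardinal.{u}) (D : Ordinal.{u} → Set Ordinal.{u})
    (σ : Ordinal.{u} → ℕ → Cardinal.{u}) : Prop where
  subset : ∀ α, D α ⊆ Iio α
  cofinal : ∀ α < lam.ord, ∀ β < α, ∃ γ ∈ D α, β ≤ γ
  exists_mk_le : ∀ α < lam.ord, ∃ n, #(D α) ≤ Cardinal.lift.{u + 1} (σ α n)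
  coherent : ∀ α < lam.ord,
    (∀ g : ℕ → Ordinal.{u}, (∀ k, g k < α) → ∃ β < α, ∀ k, g k < β) →
    ∀ g : ℕ → Ordinal.{u}, (∀ k, g k ∈ D α) → ∃ β ∈ D α, (∀ k, g k ∈ D β) ∧
      ∀ n, #(D α) ≤ Cardinal.lift.{u + 1} (σ α n) → #(D β) ≤ Cardinal.lift.{u + 1} (σ β n)
  monotone_nat : ∀ α, Monotone (σ α)
  monotone_ordinal : Monotone σ
  aleph_one_le : ∀ α n, ℵ₁ ≤ σ α n
  power_le : ∀ α n, σ α n ^ (ℵ₀ : Cardinal.{u}) ≤ σ α n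

/-- The rank of `y` is the first stage `α` at which `y` enters some `K α n`, the closure of what the
stages in `D α` contribute to `M α n`. The operation `T` lets an element pull a prescribed set into
the segment ending at its own rank. -/
theorem IsScheme.exists_ranking {Y : Type u} {lam : Cardinal.{u}} (hY : #Y ≤ lam)
    {D : Ordinal.{u} → Set Ordinal.{u}} {σ : Ordinal.{u} → ℕ → Cardinal.{u}}
    (hs : IsScheme lam D σ)
    (Φ : (ℕ → Y) → Set Y) (hΦ : ∀ g, #(Φ g) ≤ ℵ₁)
    (T : Ordinal.{u} → Set Y → Y → Set Y) (hT : ∀ α S y, #(T α S y) ≤ ⨆ n, σ α n) :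
    ∃ ρ : Y → Ordinal.{u}, (∀ y, ρ y < lam.ord) ∧
      (∀ α < lam.ord, #{y | ρ y ≤ α} ≤ ⨆ n, σ α n) ∧
      (∀ α < lam.ord, ∃ N : ℕ → Set Y, (∀ n, SeqClosed Φ (N n)) ∧ {y | ρ y < α} = ⋃ n, N n) ∧
      ∀ y, T (ρ y) {z | ρ z < ρ y} y ⊆ {z | ρ z ≤ ρ y} := by
  obtain ⟨hD, hDcof, hDcard, hDcoh, hσn, hσα, hσ1, hσpow⟩ := hs
  have hσ0 : ∀ α n, ℵ₀ ≤ σ α n := fun α n ↦ aleph0_lt_aleph_one.le.trans (hσ1 α n)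
  choose Tn hTmono hTcard hTun using
    fun α S y ↦ exists_iUnion_eq_mk_le (T α S y) (σ α) (hσn α) (hT α S y)
  obtain ⟨e, he, helt⟩ := exists_injective_ordinal hY
  let F (α : Ordinal.{u}) (S : Set Y) (n : ℕ) (g : ℕ → Y) : Set Y := Φ g ∪ Tn α S (g 0) n
  -- Pieces with `σ α n` below the size of `D α` inherit nothing, which keeps `M α n` of size at
  -- most `σ α n`. Nothing is lost, since the pieces increase with `n` and `D α` fits under some `σ
  -- α n`. Adding `e ⁻¹' {α}` ensures that every element enters eventually.
  obtain ⟨M, K, hM, hK⟩ := exists_ordinal_recursion D hD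
    (fun α n ↦ #(D α) ≤ Cardinal.lift.{u + 1} (σ α n))
    fun α M n ↦ seqClosure (F α (⋃ m, M m) n) (M n ∪ e ⁻¹' {α})
  have hMK : ∀ α n, M α n ⊆ K α n := fun α n ↦ by
    rw [hK]
    exact subset_union_left.trans (subset_seqClosure _ _)
  have hKclosed : ∀ α n, SeqClosed (F α (⋃ m, M α m) n) (K α n) := fun α n ↦ by
    rw [hK]
    exact seqClosed_seqClosure _ _
  have hKΦ : ∀ α n, SeqClosed Φ (K α n) := fun α n ↦
    (hKclosed α n).anti fun g ↦ subset_union_left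
  have hcmono : ∀ {α m n}, m ≤ n → #(D α) ≤ Cardinal.lift.{u + 1} (σ α m) →
      #(D α) ≤ Cardinal.lift.{u + 1} (σ α n) :=
    fun h h' ↦ h'.trans (Cardinal.lift_le.2 (hσn _ h))
  have hKmono : ∀ α, Monotone (K α) := by
    intro α
    induction α using WellFoundedLT.induction with
    | ind α ih =>
      intro m n hmn
      simp only [hK]
      refine seqClosure_mono (fun g ↦ union_subset_union_right _ (hTmono _ _ _ hmn))
        (union_subset_union_left _ fun y hy ↦ ?_)
      obtain ⟨hc, β, hβ, hyβ⟩ := (hM _ _ _).1 hy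
      exact (hM _ _ _).2 ⟨hcmono hmn hc, β, hβ, ih β (hD α hβ) hmn hyβ⟩
  have hKM : ∀ α < lam.ord, ∀ β < α, ∀ n, K β n ⊆ ⋃ m, M α m := by
    intro α
    induction α using WellFoundedLT.induction with
    | ind α ih =>
      intro hα β hβ n y hy
      obtain ⟨γ, hγ, hβγ⟩ := hDcof α hα β hβ
      obtain ⟨p, hp⟩ : ∃ p, y ∈ K γ p := by
        rcases hβγ.eq_or_lt with rfl | hlt
        · exact ⟨n, hy⟩
        · obtain ⟨p, hp⟩ := mem_iUnion.1 (ih γ (hD α hγ) ((hD α hγ).trans hα) β hlt n hy)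
          exact ⟨p, hMK _ _ hp⟩
      obtain ⟨m, hm⟩ := hDcard α hα
      exact mem_iUnion.2 ⟨max m p, (hM _ _ _).2
        ⟨hcmono (le_max_left _ _) hm, γ, hγ, hKmono γ (le_max_right _ _) hp⟩⟩
  have heK : ∀ y, y ∈ K (e y) 0 := fun y ↦ by
    rw [hK]
    exact subset_seqClosure _ _ (Or.inr rfl)
  let ρ : Y → Ordinal.{u} := fun y ↦ sInf {α | ∃ n, y ∈ K α n}
  have hρmem : ∀ y, ∃ n, y ∈ K (ρ y) n := fun y ↦
    csInf_mem (s := {α | ∃ n, y ∈ K α n}) ⟨e y, 0, heK y⟩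
  have hρle : ∀ {y α n}, y ∈ K α n → ρ y ≤ α := fun {y α n} h ↦ csInf_le' ⟨n, h⟩
  have hρlt : ∀ y, ρ y < lam.ord := fun y ↦ (hρle (heK y)).trans_lt (helt y)
  have hltM : ∀ α < lam.ord, {y | ρ y < α} = ⋃ m, M α m := by
    intro α hα
    ext y
    constructor
    · intro hy
      obtain ⟨n, hn⟩ := hρmem y
      exact hKM α hα _ hy n hn
    · intro hy
      obtain ⟨n, hn⟩ := mem_iUnion.1 hy
      obtain ⟨-, β, hβ, hyβ⟩ := (hM _ _ _).1 hn
      exact (hρle hyβ).trans_lt (hD α hβ)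
  have hleK : ∀ α, α < lam.ord → {y | ρ y ≤ α} = ⋃ m, K α m := by
    intro α hα
    ext y
    constructor
    · intro hy
      rcases (show ρ y ≤ α from hy).eq_or_lt with h | h
      · rw [← h]
        exact mem_iUnion.2 (hρmem y)
      · have : y ∈ {y | ρ y < α} := h
        rw [hltM α hα] at this
        exact iUnion_mono (hMK α) this
    · intro hy
      obtain ⟨n, hn⟩ := mem_iUnion.1 hy
      exact hρle hn
  have hKcard : ∀ α n, #(K α n) ≤ σ α n := by
    intro α
    induction α using WellFoundedLT.induction with
    | ind α ih =>
      intro n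
      rw [hK]
      refine mk_seqClosure_le (hσ0 α n) (hσpow α n) (fun g ↦ ?_) ?_
      · exact (mk_union_le _ _).trans (add_le_of_le (hσ0 α n) ((hΦ g).trans (hσ1 α n)) (hTcard _ _ _ n))
      · refine (mk_union_le _ _).trans (add_le_of_le (hσ0 α n) ?_ ?_)
        · by_cases hc : #(D α) ≤ Cardinal.lift.{u + 1} (σ α n)
          · have hsub : M α n ⊆ ⋃ β ∈ D α, K β n := fun y hy ↦ by
              obtain ⟨-, β, hβ, hyβ⟩ := (hM _ _ _).1 hy
              exact mem_biUnion hβ hyβ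
            refine (mk_le_mk_of_subset hsub).trans ?_
            rw [biUnion_eq_iUnion]
            refine mk_iUnion_le_of_le (hσ0 α n) (by rwa [Cardinal.lift_id'.{u, u + 1}]) _ fun β ↦ ?_
            exact (ih β (hD α β.2) n).trans (hσα (hD α β.2).le n)
          · have : M α n = ∅ := by
              ext y
              simp [hM, hc]
            simp [this]
        · refine le_trans (mk_le_one_iff_set_subsingleton.2 ?_) (one_le_aleph0.trans (hσ0 α n))
          exact fun a ha b hb ↦ he (ha.trans hb.symm)
  refine ⟨ρ, hρlt, ?_, ?_, ?_⟩
  · intro α hα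
    rw [hleK α hα]
    have hle : ∀ n, σ α n ≤ ⨆ n, σ α n := fun n ↦ le_ciSup Cardinal.bddAbove_of_small n
    refine mk_iUnion_le_of_le ((hσ0 α 0).trans (hle 0)) ?_ _ fun n ↦ (hKcard α n).trans (hle n)
    simpa using (hσ0 α 0).trans (hle 0)
  · intro α hα
    -- With a countable cofinal sequence of stages, the closed sets `K (g k) m` already exhaust the
    -- segment.
    by_cases hcof : ∃ g : ℕ → Ordinal.{u}, (∀ k, g k < α) ∧ ∀ β < α, ∃ k, β ≤ g k
    · obtain ⟨g, hg, hgcof⟩ := hcof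
      refine ⟨fun p ↦ K (g p.unpair.1) p.unpair.2, fun p ↦ hKΦ _ _, ?_⟩
      ext y
      rw [hltM α hα]
      simp only [mem_iUnion]
      constructor
      · rintro ⟨n, hn⟩
        obtain ⟨-, β, hβ, hyβ⟩ := (hM _ _ _).1 hn
        obtain ⟨k, hk⟩ := hgcof β (hD α hβ)
        have : y ∈ {y | ρ y ≤ g k} := (hρle hyβ).trans hk
        rw [hleK _ ((hg k).trans hα)] at this
        obtain ⟨m, hm⟩ := mem_iUnion.1 this
        exact ⟨Nat.pair k m, by simpa using hm⟩
      · rintro ⟨p, hp⟩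
        exact mem_iUnion.1 (hKM α hα _ (hg _) _ hp)
    · push Not at hcof
      -- Otherwise `M α n` itself is closed: by coherence, the countably many stages feeding a
      -- sequence in it all lie in one `D β` with `β ∈ D α`, so the sequence lies in the closed set
      -- `K β n`.
      refine ⟨M α, fun n f hf ↦ ?_, hltM α hα⟩
      choose hc g hg hfg using fun k ↦ (hM _ _ _).1 (hf k)
      obtain ⟨β, hβ, hgβ, hcβ⟩ := hDcoh α hα hcof g hg
      refine (hKΦ β n f fun k ↦ hMK β n ?_).trans fun y hy ↦ (hM _ _ _).2 ⟨hc 0, β, hβ, hy⟩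
      exact (hM _ _ _).2 ⟨hcβ n (hc 0), g k, hgβ k, hfg k⟩
  · intro y x hx
    rw [hltM _ (hρlt y), ← hTun] at hx
    obtain ⟨m, hm⟩ := mem_iUnion.1 hx
    obtain ⟨n, hn⟩ := hρmem y
    refine hρle (n := max m n) (hKclosed (ρ y) (max m n) (fun _ ↦ y)
      (fun _ ↦ hKmono _ (le_max_right m n) hn) (Or.inr ?_))
    exact hTmono _ _ _ (le_max_left m n) hm

/-! ### Colourings: the base case and gluing along a rank. -/

/-- There is a colouring with `ω₁` colours such that every `A i` takes all but countably many
colours exactly once. -/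
def HasColoring {X ι : Type u} (A : ι → Set X) : Prop :=
  ∃ f : X → (ℵ₁ : Cardinal.{u}).ord.ToType, ∀ i, {ξ | ¬ ∃! x, x ∈ A i ∧ f x = ξ}.Countable

/-- Almost disjoint families of at most `lam` sets, all of the same size between `ℵ₁` and `lam`,
have colourings. -/
def AllColorable (lam : Cardinal.{u}) : Prop :=
  ∀ (X ι : Type u) (κ : Cardinal.{u}) (A : ι → Set X), ℵ₁ ≤ κ → κ ≤ lam → #ι ≤ lam →
    (∀ i, #(A i) = κ) → (∀ i j, i ≠ j → (A i ∩ A j).Finite) → HasColoring A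

theorem exists_injective_choice {P X : Type u} {c : Cardinal.{u}} (hP : #P ≤ c)
    (B : P → Set X) (hB : ∀ p, c ≤ #(B p)) :
    ∃ x : P → X, Function.Injective x ∧ ∀ p, x p ∈ B p := by
  obtain ⟨o, ho, hlt⟩ := exists_injective_ordinal hP
  have wf : WellFounded fun p q ↦ o p < o q := InvImage.wf o Ordinal.lt_wf
  have hne : ∀ p (rec : ∀ q, o q < o p → X), ∃ y ∈ B p, ∀ q h, rec q h ≠ y := by
    intro p rec
    by_contra! hcon
    have h1 : #(B p) ≤ #{q // o q < o p} := by
      refine (mk_le_mk_of_subset (t := range fun q : {q // o q < o p} ↦ rec q.1 q.2) ?_).trans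
        mk_range_le
      intro y hy
      obtain ⟨q, h, rfl⟩ := hcon y hy
      exact ⟨⟨q, h⟩, rfl⟩
    have h2 : #{q // o q < o p} ≤ (o p).card :=
      mk_le_of_injective (β := (o p).ToType) (f := fun q ↦ ToType.mk ⟨o q.1, q.2⟩)
        (fun a b hab ↦ Subtype.ext (ho (congrArg Subtype.val (ToType.mk.injective hab))))
        |>.trans_eq (mk_toType _)
    exact ((hB p).trans (h1.trans h2)).not_gt (lt_ord.1 (hlt p))
  choose! φ hφ hφne using hne
  let x : P → X := wf.fix φ
  have hx : ∀ p, x p = φ p fun q _ ↦ x q := fun p ↦ wf.fix_eq φ p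
  have hne : ∀ p q, o q < o p → x q ≠ x p := fun p q h ↦ by
    rw [hx p]
    exact hφne p (fun q _ ↦ x q) q h
  refine ⟨x, fun p q hpq ↦ ?_, fun p ↦ by rw [hx]; exact hφ _ _⟩
  rcases lt_trichotomy (o p) (o q) with h | h | h
  · exact (hne _ _ h hpq).elim
  · exact ho h
  · exact (hne _ _ h hpq.symm).elim

theorem aleph_one_le_mk_iff {X : Type u} {s : Set X} : ℵ₁ ≤ #s ↔ ¬ s.Countable := by
  rw [← succ_aleph0, Order.succ_le_iff, ← not_le, le_aleph0_iff_set_countable]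

/-- For each colour `ξ` and each of the countably many sets indexed before `ξ`, a new point of that
set is chosen outside all the other sets indexed before `ξ`, and is coloured `ξ`. A set then sees
each later colour exactly once, apart from the default colour `c0` of the unchosen points. -/
theorem allColorable_aleph_one : AllColorable.{u} ℵ₁ := by
  intro X ι κ A hκ _ hι hA hfin
  have hA' : ∀ i, ℵ₁ ≤ #(A i) := fun i ↦ by rwa [hA]
  rw [← mk_ord_toType ℵ₁] at hι
  obtain ⟨j⟩ := hι
  have hcount : ∀ ξ : (ℵ₁ : Cardinal.{u}).ord.ToType, (Iio ξ).Countable := fun ξ ↦ by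
    rw [← le_aleph0_iff_set_countable, ← Order.lt_succ_iff, succ_aleph0]
    exact (mk_Iio_lt ξ (by simp)).trans_eq (mk_ord_toType _)
  let P := {p : (ℵ₁ : Cardinal.{u}).ord.ToType × ι // j p.2 < p.1}
  have hP : #P ≤ ℵ₁ := by
    have hf : Function.Injective fun p : P ↦ (p.1.1, j p.1.2) := by
      rintro ⟨⟨a, b⟩, h⟩ ⟨⟨a', b'⟩, h'⟩ hab
      exact Subtype.ext (by simpa using hab)
    refine (mk_le_of_injective hf).trans_eq ?_
    rw [← mul_def, mk_ord_toType]
    exact mul_eq_self aleph0_lt_aleph_one.le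
  obtain ⟨x, hxinj, hx⟩ := exists_injective_choice hP
    (fun p ↦ A p.1.2 \ ⋃ i ∈ {i | i ≠ p.1.2 ∧ j i < p.1.1}, A p.1.2 ∩ A i) (by
      rintro ⟨⟨ξ, i⟩, h⟩
      rw [aleph_one_le_mk_iff]
      intro hc
      refine aleph_one_le_mk_iff.1 (hA' i) ?_
      refine (hc.union (Set.Countable.biUnion (s := {i' | i' ≠ i ∧ j i' < ξ})
        (t := fun i' _ ↦ A i ∩ A i') ?_ fun i' hi' ↦ ?_)).mono (subset_sdiff_union _ _)
      · exact ((hcount ξ).preimage j.injective).mono fun i' hi' ↦ hi'.2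
      · exact (hfin _ _ hi'.1.symm).countable)
  have : Nonempty (ℵ₁ : Cardinal.{u}).ord.ToType := by
    rw [← mk_ne_zero_iff, mk_ord_toType]
    exact (aleph0_pos.trans aleph0_lt_aleph_one).ne'
  let c0 := Classical.arbitrary (ℵ₁ : Cardinal.{u}).ord.ToType
  refine ⟨Function.extend x (fun p ↦ p.1.1) fun _ ↦ c0, fun i ↦ ?_⟩
  refine (((hcount (j i)).union (countable_singleton (j i))).union (countable_singleton c0)).mono ?_
  intro ξ hξ
  by_contra! hcon
  simp only [mem_union, mem_Iio, mem_singleton_iff, not_or, not_lt] at hcon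
  obtain ⟨⟨h1, h2⟩, h3⟩ := hcon
  have hlt : j i < ξ := h1.lt_of_ne' h2
  refine hξ ⟨x ⟨(ξ, i), hlt⟩, ⟨(hx ⟨(ξ, i), hlt⟩).1, hxinj.extend_apply _ _ _⟩, ?_⟩
  rintro y ⟨hy, hyξ⟩
  by_cases hp : ∃ p, x p = y
  · obtain ⟨⟨⟨ξ', i'⟩, hp⟩, rfl⟩ := hp
    rw [hxinj.extend_apply] at hyξ
    obtain rfl : ξ' = ξ := hyξ
    by_cases hi : i = i'
    · subst hi
      rfl
    · refine ((hx ⟨(ξ', i'), hp⟩).2 ?_).elim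
      exact mem_biUnion (show i ∈ {k | k ≠ i' ∧ j k < ξ'} from ⟨hi, hlt⟩) ⟨(hx _).1, hy⟩
  · rw [Function.extend_apply' _ _ _ hp] at hyξ
    exact (h3 hyξ.symm).elim

/-- Points lying in a set of smaller rank receive a throwaway colour `c0`, so points of `A i` of
rank above `r i` spoil only `c0`. The points of rank below `r i` spoil countably many colours, and
those of rank `r i` are handled by the colouring of that level. -/
theorem hasColoring_of_rank {X ι : Type u} {A : ι → Set X} (r : ι → Ordinal.{u})
    (s : X → Ordinal.{u}) (hcount : ∀ i, (A i ∩ {x | s x < r i}).Countable)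
    (hcol : ∀ α, HasColoring fun i : {i // r i = α} ↦
      {x | x ∈ A i ∧ s x = α ∧ ∀ j, r j < α → x ∉ A j}) : HasColoring A := by
  classical
  choose f hf using hcol
  have : Nonempty (ℵ₁ : Cardinal.{u}).ord.ToType := by
    rw [← mk_ne_zero_iff, mk_ord_toType]
    exact (aleph0_pos.trans aleph0_lt_aleph_one).ne'
  let c0 := Classical.arbitrary (ℵ₁ : Cardinal.{u}).ord.ToType
  let g : X → (ℵ₁ : Cardinal.{u}).ord.ToType := fun x ↦
    if ∀ j, r j < s x → x ∉ A j then f (s x) x else c0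
  refine ⟨g, fun i ↦ (((hf (r i) ⟨i, rfl⟩).union ((hcount i).image g)).union
    (countable_singleton c0)).mono fun ξ hξ ↦ ?_⟩
  by_contra! hcon
  simp only [mem_union, not_or, mem_ofPred_eq, not_not, mem_singleton_iff] at hcon
  obtain ⟨⟨⟨x, ⟨⟨hxA, hxs, hxj⟩, hxξ⟩, hux⟩, h2⟩, h3⟩ := hcon
  refine hξ ⟨x, ⟨hxA, ?_⟩, ?_⟩
  · simp only [g, hxs]
    rw [if_pos hxj, hxξ]
  · rintro y ⟨hyA, hyξ⟩
    have hgood : ∀ j, r j < s y → y ∉ A j := by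
      by_contra hbad
      simp only [g, if_neg hbad] at hyξ
      exact h3 hyξ.symm
    rcases lt_trichotomy (s y) (r i) with h | h | h
    · exact (h2 ⟨y, ⟨hyA, h⟩, hyξ⟩).elim
    · refine hux y ⟨⟨hyA, h, h ▸ hgood⟩, ?_⟩
      simpa only [g, if_pos hgood, h] using hyξ
    · exact (hgood i h hyA).elim

theorem mk_sdiff_eq_of_lt {X : Type u} {S T : Set X} {c : Cardinal.{u}} (hc : ℵ₀ ≤ c)
    (hS : #S = c) (hT : #T < c) : #(S \ T : Set X) = c := by
  refine ((mk_le_mk_of_subset sdiff_subset).trans_eq hS).antisymm (not_lt.1 fun h ↦ ?_)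
  exact ((add_lt_of_lt hc h hT).trans_le' (le_mk_sdiff_add_mk S T)).ne hS

/-! ### The inductive step. -/

theorem allColorable_of_scheme {lam : Cardinal.{u}} (hlam : ℵ₁ < lam)
    (hCH : (2 : Cardinal.{u}) ^ (ℵ₀ : Cardinal.{u}) ≤ ℵ₁)
    (ih : ∀ l < lam, ℵ₁ ≤ l → AllColorable l)
    (hscheme : ∀ κ < lam, ∃ D σ, IsScheme lam D σ ∧ (∀ α, κ ≤ ⨆ n, σ α n) ∧
      ∀ α < lam.ord, ⨆ n, σ α n < lam) : AllColorable lam := by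
  intro X ι κ A hκ hκlam hι hA hfin
  have hlam0 : ℵ₀ ≤ lam := aleph0_lt_aleph_one.le.trans hlam.le
  have hκ0 : ℵ₀ ≤ κ := aleph0_lt_aleph_one.le.trans hκ
  obtain ⟨D, σ, hs, hle, hlt⟩ : ∃ D σ, IsScheme lam D σ ∧
      (∀ α, ℵ₁ ≤ ⨆ n, σ α n ∧ (κ < lam → κ ≤ ⨆ n, σ α n)) ∧
      ∀ α < lam.ord, ⨆ n, σ α n < lam := by
    by_cases h : κ < lam
    · obtain ⟨D, σ, hs, h1, h2⟩ := hscheme κ h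
      exact ⟨D, σ, hs, fun α ↦ ⟨hκ.trans (h1 α), fun _ ↦ h1 α⟩, h2⟩
    · obtain ⟨D, σ, hs, h1, h2⟩ := hscheme ℵ₁ hlam
      exact ⟨D, σ, hs, fun α ↦ ⟨h1 α, fun h' ↦ (h h').elim⟩, h2⟩
  set τ : Ordinal.{u} → Cardinal.{u} := fun α ↦ ⨆ n, σ α n
  let U : Set X := ⋃ i, A i
  have hAU : ∀ i, A i ⊆ U := subset_iUnion A
  have hY : #(ι ⊕ U) ≤ lam := by
    rw [mk_sum, Cardinal.lift_id, Cardinal.lift_id]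
    exact add_le_of_le hlam0 hι (mk_iUnion_le_of_le hlam0 (by simpa using hι) A
      fun i ↦ (hA i).trans_le hκlam)
  let pts : Set (ι ⊕ U) → Set X := fun S ↦ (↑) '' (Sum.inr ⁻¹' S : Set U)
  have hpts : ∀ S, #(pts S) ≤ #S := fun S ↦
    mk_image_le.trans (mk_preimage_of_injective _ _ Sum.inr_injective)
  -- A closed set contains the index of every set that meets its points infinitely often.
  let Φ : (ℕ → ι ⊕ U) → Set (ι ⊕ U) := fun g ↦ Sum.inl '' {i | (A i ∩ pts (range g)).Infinite}
  have hΦ : ∀ g, #(Φ g) ≤ ℵ₁ := by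
    intro g
    refine mk_image_le.trans ?_
    have hinj : Function.Injective fun i : {i | (A i ∩ pts (range g)).Infinite} ↦
        (⟨A i ∩ pts (range g), inter_subset_right⟩ : 𝒫 (pts (range g))) := by
      intro i j hij
      by_contra hne
      have h : A i ∩ pts (range g) = A j ∩ pts (range g) := congrArg Subtype.val hij
      refine i.2 ((hfin i j (fun h ↦ hne (Subtype.ext h))).subset fun x hx ↦ ⟨hx.1, ?_⟩)
      rw [h] at hx
      exact hx.1
    refine (mk_le_of_injective hinj).trans ?_
    rw [mk_powerset]
    refine le_trans (power_le_power_left two_ne_zero ?_) hCH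
    exact (hpts _).trans (le_aleph0_iff_set_countable.2 (countable_range g))
  have hclosed : ∀ N, SeqClosed Φ N → ∀ i, Sum.inl i ∉ N → (A i ∩ pts N).Finite := by
    intro N hN i hi
    by_contra hinf
    have hinf : (A i ∩ pts N).Infinite := hinf
    let e := hinf.natEmbedding
    choose! u hu huv using fun k ↦ (e k).2.2
    refine hi (hN (fun k ↦ Sum.inr (u k)) hu ⟨i, ?_, rfl⟩)
    refine (infinite_range_of_injective
      (Subtype.val_injective.comp e.injective)).mono ?_
    rintro _ ⟨k, rfl⟩
    exact ⟨(e k).2.1, u k, ⟨k, rfl⟩, huv k⟩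
  -- The part of `A i` that is new over the segment `S`: neither among its points nor in any of its
  -- sets.
  let R : Set (ι ⊕ U) → ι → Set X := fun S i ↦ A i \ (pts S ∪ ⋃ j ∈ Sum.inl ⁻¹' S, A i ∩ A j)
  -- `W` is what index `i` pulls in at its rank. For `κ < lam` it is all of `A i`, so no point
  -- outranks a set containing it. For `κ = lam` this would be too large, and `τ α` new points are
  -- taken, just enough to give the trace of `A i` on its level size `τ α`.
  have hW : ∀ α S i, ∃ W : Set X, #W ≤ τ α ∧ (κ < lam → W = A i) ∧
      (κ = lam → W ⊆ R S i ∧ (τ α ≤ #(R S i) → #W = τ α)) := by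
    intro α S i
    by_cases h : κ < lam
    · exact ⟨A i, (hA i).trans_le ((hle α).2 h), fun _ ↦ rfl, fun h' ↦ (h.ne h').elim⟩
    · by_cases h' : τ α ≤ #(R S i)
      · obtain ⟨W, hWR, hW⟩ := le_mk_iff_exists_subset.1 h'
        exact ⟨W, hW.le, fun h' ↦ (h h').elim, fun _ ↦ ⟨hWR, fun _ ↦ hW⟩⟩
      · exact ⟨∅, by simp, fun h' ↦ (h h').elim, fun _ ↦ ⟨empty_subset _, fun h ↦ (h' h).elim⟩⟩
  choose W hWcard hWlt hWeq using hW
  obtain ⟨ρ, hρlt, hρcard, hρσ, hρT⟩ := hs.exists_ranking hY Φ hΦ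
    (fun α S y ↦ Sum.elim (fun i ↦ Sum.inr '' ((↑) ⁻¹' W α S i : Set U)) (fun _ ↦ ∅) y) (by
      rintro α S (i | x)
      · exact mk_image_le.trans
          ((mk_preimage_of_injective _ _ Subtype.val_injective).trans (hWcard α S i))
      · simp)
  classical
  let r : ι → Ordinal.{u} := fun i ↦ ρ (Sum.inl i)
  let s : X → Ordinal.{u} := fun x ↦ if h : x ∈ U then ρ (Sum.inr ⟨x, h⟩) else 0
  have hsx : ∀ x (h : x ∈ U), s x = ρ (Sum.inr ⟨x, h⟩) := fun x h ↦ dif_pos h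
  have hWs : ∀ i, ∀ x ∈ W (r i) {z | ρ z < r i} i, x ∈ A i → s x ≤ r i := by
    intro i x hx hxA
    rw [hsx x (hAU i hxA)]
    exact hρT (Sum.inl i) ⟨⟨x, hAU i hxA⟩, hx, rfl⟩
  have hcount : ∀ i, (A i ∩ {x | s x < r i}).Countable := by
    intro i
    obtain ⟨N, hN, hNeq⟩ := hρσ (r i) (hρlt _)
    have hiN : ∀ n, Sum.inl i ∉ N n := fun n hn ↦ by
      have : Sum.inl i ∈ {y | ρ y < r i} := hNeq ▸ mem_iUnion.2 ⟨n, hn⟩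
      exact lt_irrefl (r i) this
    refine (countable_iUnion fun n ↦ (hclosed (N n) (hN n) i (hiN n)).countable).mono ?_
    rintro x ⟨hxA, hx⟩
    have hx : Sum.inr ⟨x, hAU i hxA⟩ ∈ {y | ρ y < r i} := by
      rw [mem_ofPred_eq, ← hsx]
      exact hx
    rw [hNeq] at hx
    obtain ⟨n, hn⟩ := mem_iUnion.1 hx
    exact mem_iUnion.2 ⟨n, hxA, _, hn, rfl⟩
  refine hasColoring_of_rank r s hcount fun α ↦ ?_
  by_cases hα : α < lam.ord
  swap
  · refine ⟨fun _ ↦ ToType.mk ⟨0, ord_pos.2 (aleph0_pos.trans aleph0_lt_aleph_one)⟩, fun i ↦ ?_⟩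
    exact (hα (i.2 ▸ hρlt _)).elim
  have hια : #{i // r i = α} ≤ τ α := by
    refine (mk_le_of_injective (β := {y | ρ y ≤ α}) (f := fun i ↦ ⟨Sum.inl i.1, i.2.le⟩) ?_).trans
      (hρcard α hα)
    intro i j hij
    exact Subtype.ext (Sum.inl_injective (congrArg Subtype.val hij))
  refine ih (τ α) (hlt α hα) (hle α).1 X _ (min κ (τ α)) _ (le_min hκ (hle α).1)
    (min_le_right _ _) hια ?_ ?_
  · rintro ⟨i, rfl⟩
    rcases hκlam.lt_or_eq with hlt' | rfl
    · rw [min_eq_left ((hle _).2 hlt')]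
      rw [← mk_sdiff_eq_of_lt hκ0 (hA i) ((le_aleph0_iff_set_countable.2 (hcount i)).trans_lt
        (aleph0_lt_aleph_one.trans_le hκ))]
      have hsle : ∀ j, ∀ x ∈ A j, s x ≤ r j := fun j x hx ↦
        hWs j x (by rwa [hWlt _ _ _ hlt']) hx
      congr 2
      ext x
      constructor
      · rintro ⟨hxA, hxs, -⟩
        exact ⟨hxA, fun h ↦ h.2.ne hxs⟩
      · rintro ⟨hxA, hx⟩
        have hxs : s x = r i := (hsle i x hxA).antisymm (not_lt.1 fun h ↦ hx ⟨hxA, h⟩)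
        exact ⟨hxA, hxs, fun j hj hxj ↦ (hsle j x hxj).not_gt (hj.trans_eq hxs.symm)⟩
    · have hττ := hlt _ hα
      rw [min_eq_right hττ.le]
      set S : Set (ι ⊕ U) := {z | ρ z < r i}
      have hτ0 : ℵ₀ ≤ τ (r i) := aleph0_lt_aleph_one.le.trans (hle _).1
      have hScard : #S ≤ τ (r i) :=
        (mk_le_mk_of_subset fun z (hz : ρ z < r i) ↦ hz.le).trans (hρcard _ hα)
      have hR : #(R S i) = κ := by
        refine mk_sdiff_eq_of_lt hκ0 (hA i) (lt_of_le_of_lt ?_ hττ)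
        refine (mk_union_le _ _).trans (add_le_of_le hτ0 ((hpts S).trans hScard) ?_)
        rw [biUnion_eq_iUnion]
        refine mk_iUnion_le_of_le hτ0 ?_ _ fun j ↦ ?_
        · rw [Cardinal.lift_id, Cardinal.lift_id]
          exact (mk_preimage_of_injective _ _ Sum.inl_injective).trans hScard
        · refine le_trans (le_aleph0_iff_set_countable.2 (hfin i j ?_).countable) hτ0
          intro hij
          have h : ρ (Sum.inl j.1) < r i := j.2
          rw [← hij] at h
          exact lt_irrefl _ h
      obtain ⟨hWR, hWeq⟩ := hWeq (r i) S i rfl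
      have hWeq := hWeq (hR ▸ hττ.le)
      refine le_antisymm ?_ ?_
      · refine le_trans ?_ (hρcard (r i) hα)
        refine mk_le_of_injective (f := fun x ↦ ⟨Sum.inr ⟨x.1, hAU i x.2.1⟩, ?_⟩) ?_
        · rw [mem_ofPred_eq, ← hsx]
          exact x.2.2.1.le
        · intro x y hxy
          have h : (Sum.inr (⟨x.1, hAU i x.2.1⟩ : U) : ι ⊕ U) = Sum.inr ⟨y.1, hAU i y.2.1⟩ :=
            congrArg Subtype.val hxy
          have h := Subtype.ext_iff.1 (Sum.inr_injective h)
          exact Subtype.ext h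
      · refine hWeq.symm.trans_le (mk_le_mk_of_subset fun x hx ↦ ?_)
        obtain ⟨hxA, hxR⟩ := hWR hx
        refine ⟨hxA, (hWs i x hx hxA).antisymm (not_lt.1 fun h ↦ hxR (Or.inl ?_)),
          fun j hj hxj ↦ hxR (Or.inr (mem_biUnion (show j ∈ Sum.inl ⁻¹' S from hj) ⟨hxA, hxj⟩))⟩
        refine ⟨⟨x, hAU i hxA⟩, ?_, rfl⟩
        rw [hsx x (hAU i hxA)] at h
        exact h
  · intro i j hij
    exact (hfin i j fun h ↦ hij (Subtype.ext h)).subset fun x hx ↦ ⟨hx.1.1, hx.2.1⟩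

/-! ### Cardinal arithmetic and the construction of schemes. -/

theorem power_aleph0_idem (x : Cardinal.{u}) :
    (x ^ (ℵ₀ : Cardinal.{u})) ^ (ℵ₀ : Cardinal.{u}) = x ^ (ℵ₀ : Cardinal.{u}) := by
  rw [← power_mul, aleph0_mul_aleph0]

/-- A countable sequence in `ν` is bounded, so it is one of at most `ν` sequences into one of `ν`
initial segments. -/
theorem power_aleph0_le_of_cof_ne {ν : Cardinal.{u}} (hν : ℵ₀ ≤ ν) (hcof : ν.ord.cof ≠ ℵ₀)
    (h : ∀ x < ν, x ^ (ℵ₀ : Cardinal.{u}) ≤ ν) : ν ^ (ℵ₀ : Cardinal.{u}) ≤ ν := by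
  have hcof' : ℵ₀ < ν.ord.cof :=
    (aleph0_le_cof_iff.2 (one_lt_cof_iff.2 (isSuccLimit_ord hν))).lt_of_ne' hcof
  have h1 : ν ^ (ℵ₀ : Cardinal.{u}) = #(ULift.{u} ℕ → ν.ord.ToType) := by simp
  rw [h1, ← mk_univ]
  have hsub : (univ : Set (ULift.{u} ℕ → ν.ord.ToType)) ⊆
      ⋃ β : ν.ord.ToType, {f | ∀ k, f k < β} := by
    intro f _
    have hlt : ⨆ k, (f k).toOrd.1 + 1 < ν.ord := by
      refine Ordinal.iSup_lt_of_lt_cof (by simpa using hcof') fun k ↦ ?_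
      exact (isSuccLimit_ord hν).add_one_lt (f k).toOrd.2
    refine mem_iUnion.2 ⟨ToType.mk ⟨_, hlt⟩, fun k ↦ ?_⟩
    rw [← ToType.mk.symm.lt_iff_lt, OrderIso.symm_apply_apply, ← Subtype.coe_lt_coe]
    exact (Order.lt_add_one_iff.2 (le_refl (f k).toOrd.1)).trans_le
      (Ordinal.le_iSup (fun k ↦ (f k).toOrd.1 + 1) k)
  refine (mk_le_mk_of_subset hsub).trans (mk_iUnion_le_of_le hν (by simp) _ fun β ↦ ?_)
  refine le_trans ?_ (h #(Iio β) ((mk_Iio_lt β (by simp)).trans_eq (mk_ord_toType _)))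
  have h2 : #(Iio β) ^ (ℵ₀ : Cardinal.{u}) = #(ULift.{u} ℕ → Iio β) := by simp
  rw [h2]
  refine mk_le_of_injective (f := fun f k ↦ ⟨f.1 k, f.2 k⟩) fun f g hfg ↦ ?_
  exact Subtype.ext (funext fun k ↦ congrArg Subtype.val (congrFun hfg k))

theorem power_aleph0_le {lam : Cardinal.{u}}
    (hpow : ∀ μ : Cardinal.{u}, μ < lam → μ.ord.cof = ℵ₀ →
      μ ^ (ℵ₀ : Cardinal.{u}) = Order.succ μ) (ν : Cardinal.{u}) (hν : ℵ₀ ≤ ν) (hνlam : ν < lam) :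
    ν ^ (ℵ₀ : Cardinal.{u}) ≤ Order.succ ν ∧
      (ν.ord.cof ≠ ℵ₀ → ν ^ (ℵ₀ : Cardinal.{u}) ≤ ν) := by
  induction ν using WellFoundedLT.induction with
  | ind ν ih =>
    have key : ν.ord.cof ≠ ℵ₀ → ν ^ (ℵ₀ : Cardinal.{u}) ≤ ν := by
      intro hcof
      have hν' : ℵ₀ < ν := hν.lt_of_ne (by rintro rfl; simp at hcof)
      refine power_aleph0_le_of_cof_ne hν hcof fun x hx ↦ ?_
      have hx' : max x ℵ₀ < ν := max_lt hx hν'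
      exact (power_le_power_right (le_max_left x ℵ₀)).trans
        ((ih _ hx' (le_max_right _ _) (hx'.trans hνlam)).1.trans (Order.succ_le_of_lt hx'))
    refine ⟨?_, key⟩
    by_cases hcof : ν.ord.cof = ℵ₀
    · exact (hpow ν hνlam hcof).le
    · exact (key hcof).trans (Order.le_succ ν)

/-- No splitting is needed here: each stage uses all its predecessors and a single size closed under
countable powers. -/
theorem exists_scheme_of_power_lt {lam : Cardinal.{u}} (hlam : ℵ₁ < lam)
    (hpow : ∀ x < lam, x ^ (ℵ₀ : Cardinal.{u}) < lam) {κ : Cardinal.{u}} (hκ : κ < lam) :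
    ∃ D σ, IsScheme lam D σ ∧ (∀ α, κ ≤ ⨆ n, σ α n) ∧ ∀ α < lam.ord, ⨆ n, σ α n < lam := by
  have hself : ∀ x : Cardinal.{u}, x ≤ x ^ (ℵ₀ : Cardinal.{u}) :=
    fun x ↦ self_le_power x one_le_aleph0
  let τ (α : Ordinal.{u}) : Cardinal.{u} := max α.card (max κ ℵ₁) ^ (ℵ₀ : Cardinal.{u})
  have hcard : ∀ α, #(Iio α) ≤ Cardinal.lift.{u + 1} (τ α) := fun α ↦ by
    rw [Cardinal.mk_Iio_ordinal, Cardinal.lift_le]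
    exact (le_max_left _ _).trans (hself _)
  refine ⟨Iio, fun α _ ↦ τ α, ⟨fun _ ↦ subset_rfl, fun α _ β hβ ↦ ⟨β, hβ, le_rfl⟩,
    fun α _ ↦ ⟨0, hcard α⟩, fun α _ h g hg ↦ ?_, fun _ ↦ monotone_const, fun α β h n ↦ ?_,
    fun α _ ↦ ?_, fun α _ ↦ (power_aleph0_idem _).le⟩, fun α ↦ ?_, fun α hα ↦ ?_⟩
  · obtain ⟨β, hβ, hgβ⟩ := h g hg
    exact ⟨β, hβ, hgβ, fun _ _ ↦ hcard β⟩
  · exact power_le_power_right (max_le_max_right _ (card_le_card h))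
  · exact ((le_max_right _ _).trans (le_max_right _ _)).trans (hself _)
  · rw [ciSup_const]
    exact ((le_max_left _ _).trans (le_max_right _ _)).trans (hself _)
  · rw [ciSup_const]
    exact hpow _ (max_lt (lt_ord.1 hα) (max_lt hκ hlam))

theorem exists_seq_iSup_eq {μ : Cardinal.{u}} (hμ : μ.IsSingular) (hμ1 : ℵ₁ < μ)
    (hcof : μ.ord.cof = ℵ₀) (hpow : ∀ x < μ, x ^ (ℵ₀ : Cardinal.{u}) < μ) :
    ∃ m : ℕ → Cardinal.{u}, Monotone m ∧ (∀ n, ℵ₁ ≤ m n) ∧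
      (∀ n, m n ^ (ℵ₀ : Cardinal.{u}) ≤ m n) ∧ ⨆ n, m n = μ := by
  obtain ⟨s, hs, hscard⟩ := Order.exists_cof_eq μ.ord.ToType
  rw [cof_toType, hcof] at hscard
  have hsne : s.Nonempty := by
    rw [← nonempty_coe_sort, ← mk_ne_zero_iff, hscard]
    exact aleph0_ne_zero
  obtain ⟨x, rfl⟩ := (le_aleph0_iff_set_countable.1 hscard.le).exists_eq_range hsne
  let c : ℕ → Cardinal.{u} := fun n ↦ (x n).toOrd.1.card
  have hc : ∀ n, c n < μ := fun n ↦ lt_ord.1 (x n).toOrd.2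
  let m : ℕ → Cardinal.{u} := fun n ↦ max ℵ₁ (partialSups c n) ^ (ℵ₀ : Cardinal.{u})
  have hself : ∀ x : Cardinal.{u}, x ≤ x ^ (ℵ₀ : Cardinal.{u}) :=
    fun x ↦ self_le_power x one_le_aleph0
  have hm : ∀ n, m n < μ := by
    intro n
    refine hpow _ (max_lt hμ1 ?_)
    induction n with
    | zero => simpa using hc 0
    | succ n ih =>
      rw [partialSups_add_one]
      exact max_lt ih (hc _)
  refine ⟨m, fun a b h ↦ power_le_power_right (max_le_max_left _ ((partialSups c).mono h)),
    fun n ↦ (le_max_left _ _).trans (hself _), fun n ↦ (power_aleph0_idem _).le, ?_⟩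
  refine (ciSup_le' fun n ↦ (hm n).le).antisymm (not_lt.1 fun h ↦ ?_)
  have h' : Order.succ (⨆ n, m n) < μ := hμ.isSuccLimit.succ_lt h
  obtain ⟨_, ⟨k, rfl⟩, hk⟩ := hs (ToType.mk ⟨_, ord_lt_ord.2 h'⟩)
  rw [← ToType.mk.symm.le_iff_le, OrderIso.symm_apply_apply] at hk
  have hk : (Order.succ (⨆ n, m n)).ord ≤ (x k).toOrd.1 := hk
  have h1 : c k ≤ ⨆ n, m n := ((le_partialSups c k).trans (le_max_right _ _)).trans
    ((hself _).trans (le_ciSup Cardinal.bddAbove_of_small k))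
  exact ((ord_le.1 hk).trans h1).not_gt (Order.lt_succ _)

/-- At limits `D` is the square sequence, whose members have size below `μ` and hence below some `m
n`; at successors it is the predecessor alone. -/
theorem exists_scheme_of_square {μ : Cardinal.{u}} (hμ : μ.IsSingular) (hμ1 : ℵ₁ < μ)
    (hcof : μ.ord.cof = ℵ₀) (hpow : ∀ x < μ, x ^ (ℵ₀ : Cardinal.{u}) < μ) (hsq : Square μ)
    {κ : Cardinal.{u}} (hκ : κ < Order.succ μ) :
    ∃ D σ, IsScheme (Order.succ μ) D σ ∧ (∀ α, κ ≤ ⨆ n, σ α n) ∧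
      ∀ α < (Order.succ μ).ord, ⨆ n, σ α n < Order.succ μ := by
  classical
  obtain ⟨m, hmono, hm1, hmpow, hsup⟩ := exists_seq_iSup_eq hμ hμ1 hcof hpow
  obtain ⟨C, hC⟩ := hsq
  let D (α : Ordinal.{u}) : Set Ordinal.{u} :=
    if Order.IsSuccLimit α ∧ α < (Order.succ μ).ord then C α else {β | Order.succ β = α}
  have hDlim : ∀ {α}, Order.IsSuccLimit α → α < (Order.succ μ).ord → D α = C α :=
    fun h h' ↦ if_pos ⟨h, h'⟩
  refine ⟨D, fun _ ↦ m, ⟨fun α ↦ ?_, fun α hα β hβ ↦ ?_, fun α hα ↦ ?_, fun α hα h g hg ↦ ?_,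
    fun _ ↦ hmono, fun _ _ _ ↦ le_rfl, fun _ ↦ hm1, fun _ ↦ hmpow⟩, fun α ↦ ?_, fun α _ ↦ ?_⟩
  · by_cases h : Order.IsSuccLimit α ∧ α < (Order.succ μ).ord
    · rw [hDlim h.1 h.2]
      exact (hC α h.1 h.2).1.subset
    · simp only [D, if_neg h]
      rintro β rfl
      exact Order.lt_succ β
  · rcases zero_or_succ_or_isSuccLimit α with rfl | ⟨γ, rfl⟩ | h
    · exact (not_lt_zero hβ).elim
    · refine ⟨γ, ?_, Order.lt_succ_iff.1 hβ⟩
      simp [D]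
    · rw [hDlim h hα]
      obtain ⟨γ, hγ, hlt⟩ := (hC α h hα).1.unbounded β hβ
      exact ⟨γ, hγ, hlt.le⟩
  · by_cases h : Order.IsSuccLimit α
    · rw [hDlim h hα]
      -- The cofinality of a limit ordinal is regular, so it cannot equal the singular `μ`.
      have hαcof : α.cof < μ := by
        have h1 : α.cof ≤ μ := (cof_le_card α).trans (card_le_iff.2 hα)
        refine h1.lt_of_ne fun h2 ↦ hμ.not_isRegular ?_
        rw [← h2]
        exact isRegular_cof h
      have h1 : #(C α) < Cardinal.lift.{u + 1} μ := by
        have := (hC α h hα).2.2 hαcof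
        rwa [lift_ord, lt_ord, card_type] at this
      obtain ⟨x, hx⟩ := mem_range_lift_of_le h1.le
      rw [← hx, Cardinal.lift_lt, ← hsup] at h1
      obtain ⟨n, hn⟩ := exists_lt_of_lt_ciSup h1
      exact ⟨n, by rw [← hx, Cardinal.lift_le]; exact hn.le⟩
    · refine ⟨0, (mk_le_one_iff_set_subsingleton.2 ?_).trans
        (one_le_aleph0.trans (aleph0_le_lift.2 (aleph0_lt_aleph_one.le.trans (hm1 0))))⟩
      simp only [D, h, false_and, if_false]
      exact fun a ha b hb ↦ Order.succ_injective (ha.trans hb.symm)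
  · rcases zero_or_succ_or_isSuccLimit α with rfl | ⟨γ, rfl⟩ | hlim
    · have := hg 0
      simp [D] at this
    · obtain ⟨β, hβ, hγβ⟩ := h (fun _ ↦ γ) fun _ ↦ Order.lt_succ γ
      exact ((Order.lt_succ_iff.1 hβ).not_gt (hγβ 0)).elim
    · rw [hDlim hlim hα] at hg ⊢
      obtain ⟨⟨hsub, hunb, hcl⟩, hcoh, -⟩ := hC α hlim hα
      obtain ⟨β₀, hβ₀, hgβ₀⟩ := h g fun k ↦ hsub (hg k)
      choose! next hnext hltnext using hunb
      -- Climbing `ω` steps through `C α` above a bound of `g` reaches a limit point of `C α`. It is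
      -- still below `α` because countable sets are bounded in `α`, and there `C` is an initial
      -- segment of `C α` containing all `g k`.
      let o : ℕ → Ordinal.{u} := fun n ↦ next^[n] β₀
      have ho : ∀ n, o n < α := fun n ↦ by
        induction n with
        | zero => exact hβ₀
        | succ n ih =>
          simp only [o, Function.iterate_succ_apply']
          exact hsub (hnext _ ih)
      have hosucc : ∀ n, o (n + 1) = next (o n) := fun n ↦ Function.iterate_succ_apply' _ _ _
      have hoC : ∀ n, o (n + 1) ∈ C α := fun n ↦ hosucc n ▸ hnext _ (ho n)
      have holt : ∀ n, o n < o (n + 1) := fun n ↦ hosucc n ▸ hltnext _ (ho n)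
      obtain ⟨β₁, hβ₁, hoβ₁⟩ := h o ho
      have hle : ∀ n, o n ≤ ⨆ n, o n := fun n ↦ Ordinal.le_iSup o n
      have hlt : ∀ n, o n < ⨆ n, o n := fun n ↦ (holt n).trans_le (hle _)
      have hβα : ⨆ n, o n < α := (Ordinal.iSup_le fun n ↦ (hoβ₁ n).le).trans_lt hβ₁
      have hlp : IsLimitPoint (C α) (⨆ n, o n) := by
        refine ⟨zero_le.trans_lt (hlt 0), fun γ hγ ↦ ?_⟩
        obtain ⟨n, hn⟩ := (Ordinal.lt_iSup_iff).1 hγ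
        exact ⟨o (n + 1), hoC n, hn.trans (holt n), hlt _⟩
      have hβlim : Order.IsSuccLimit (⨆ n, o n) := by
        rw [isSuccLimit_iff, Order.isSuccPrelimit_iff_succ_lt]
        refine ⟨hlp.1.ne', fun γ hγ ↦ ?_⟩
        obtain ⟨δ, -, h1, h2⟩ := hlp.2 γ hγ
        exact (Order.succ_le_of_lt h1).trans_lt h2
      refine ⟨⨆ n, o n, hcl _ hβα hlp, ?_⟩
      rw [hDlim hβlim (hβα.trans hα), hcoh _ hβα hlp]
      exact ⟨fun k ↦ ⟨hg k, (hgβ₀ k).trans (hlt 0)⟩,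
        fun n hn ↦ (mk_le_mk_of_subset inter_subset_left).trans hn⟩
  · rw [hsup]
    exact Order.lt_succ_iff.1 hκ
  · rw [hsup]
    exact Order.lt_succ μ

/-! ### The induction on `lam` and the main theorem. -/

theorem allColorable {lam : Cardinal.{u}} (hlam : ℵ₁ ≤ lam)
    (hpow : ∀ μ : Cardinal.{u}, μ < lam → μ.ord.cof = ℵ₀ →
      μ ^ (ℵ₀ : Cardinal.{u}) = Order.succ μ)
    (hsquare : ∀ μ : Cardinal.{u}, μ < lam → μ.IsSingular → μ.ord.cof = ℵ₀ → Square μ) :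
    AllColorable lam := by
  induction lam using WellFoundedLT.induction with
  | ind lam ih =>
    rcases hlam.eq_or_lt with rfl | hlam
    · exact allColorable_aleph_one
    have hω : (ℵ₀ : Cardinal.{u}) ^ (ℵ₀ : Cardinal.{u}) = ℵ₁ := by
      rw [hpow ℵ₀ (aleph0_lt_aleph_one.trans hlam) (by simp), succ_aleph0]
    refine allColorable_of_scheme hlam ?_ (fun l hl hl1 ↦ ih l hl hl1
      (fun μ hμ ↦ hpow μ (hμ.trans hl)) fun μ hμ ↦ hsquare μ (hμ.trans hl)) fun κ hκ ↦ ?_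
    · rw [← hω]
      exact power_le_power_right (natCast_le_aleph0 (n := 2))
    by_cases hlt : ∀ x < lam, x ^ (ℵ₀ : Cardinal.{u}) < lam
    · exact exists_scheme_of_power_lt hlam hlt hκ
    push Not at hlt
    -- A failure `lam ≤ μ ^ ℵ₀` forces `μ` to have cofinality `ω`, and then `μ ^ ℵ₀ ≤ μ⁺` forces
    -- `lam = μ⁺`.
    obtain ⟨μ, hμ, hμpow⟩ := hlt
    have hμ0 : ℵ₀ < μ := by
      by_contra! h
      exact (hμpow.trans ((power_le_power_right h).trans_eq hω)).not_gt hlam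
    obtain ⟨h1, h2⟩ := power_aleph0_le hpow μ hμ0.le hμ
    have hcof : μ.ord.cof = ℵ₀ := by
      by_contra h
      exact (hμpow.trans (h2 h)).not_gt hμ
    obtain rfl : lam = Order.succ μ := (hμpow.trans h1).antisymm (Order.succ_le_of_lt hμ)
    have hsing : μ.IsSingular := ⟨hμ0.le, by rw [hcof]; exact hμ0.ne⟩
    have hμ1 : ℵ₁ < μ := by
      rw [← succ_aleph0]
      exact hsing.isSuccLimit.succ_lt hμ0
    refine exists_scheme_of_square hsing hμ1 hcof (fun x hx ↦ ?_)
      (hsquare μ hμ hsing hcof) hκ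
    have hx' : max x ℵ₀ < μ := max_lt hx hμ0
    exact (power_le_power_right (le_max_left x ℵ₀)).trans_lt
      ((power_aleph0_le hpow _ (le_max_right _ _) (hx'.trans hμ)).1.trans_lt
        (hsing.isSuccLimit.succ_lt hx'))

end ConflictFree

theorem mainTheorem8 (lam : Cardinal.{u}) (hlam : ℵ₀ < lam)
    (hpow : ∀ μ : Cardinal.{u}, μ < lam → μ.ord.cof = ℵ₀ → μ ^ (ℵ₀ : Cardinal.{u}) = Order.succ μ)
    (hsquare : ∀ μ : Cardinal.{u}, μ < lam → μ.IsSingular → μ.ord.cof = ℵ₀ →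
      ConflictFree.Square μ)
    (κ : Cardinal.{u}) (hκ : ℵ₁ ≤ κ) (hκlam : κ ≤ lam) :
    ConflictFree.DoubleArrow lam κ ℵ₀ ℵ₁ ∧ ConflictFree.chiCFSup lam κ ℵ₀ ≤ ℵ₁ := by
  have harrow : ConflictFree.DoubleArrow lam κ ℵ₀ ℵ₁ := by
    intro X 𝒜 h𝒜
    obtain ⟨f, hf⟩ := ConflictFree.allColorable (hκ.trans hκlam) hpow hsquare X 𝒜 κ (↑) hκ hκlam
      h𝒜.card_eq.le (fun A ↦ h𝒜.card_mem A A.2) fun A B hAB ↦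
        lt_aleph0_iff_set_finite.1 (h𝒜.almostDisjoint A A.2 B B.2 fun h ↦ hAB (Subtype.ext h))
    refine ⟨fun x ↦ f x, fun A hA ↦ ?_⟩
    refine (le_aleph0_iff_set_countable.2 ?_).trans_lt aleph0_lt_aleph_one
    refine (hf ⟨A, hA⟩).mono fun ξ hξ ↦ ?_
    rw [mem_compl_iff] at hξ
    intro h
    refine hξ ?_
    obtain ⟨x, ⟨hxA, hxξ⟩, hux⟩ : ∃! x, x ∈ A ∧ f x = ξ := h
    have hxU : x ∈ ⋃₀ 𝒜 := ⟨A, hA, hxA⟩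
    refine ⟨⟨⟨x, hxU⟩, hxξ⟩, mk_set_eq_one_iff.2 ⟨x, ?_⟩⟩
    ext y
    constructor
    · rintro ⟨hyA, z, hz, rfl⟩
      exact hux _ ⟨hyA, hz⟩
    · rintro rfl
      exact ⟨hxA, ⟨y, hxU⟩, hxξ, rfl⟩
  refine ⟨harrow, csSup_le' ?_⟩
  rintro _ ⟨X, 𝒜, h𝒜, rfl⟩
  obtain ⟨f, hf⟩ := harrow X 𝒜 h𝒜
  refine csInf_le' ⟨f, fun A hA ↦ ?_⟩
  by_contra! hne
  have huniv : (ConflictFree.uniqueColors f A)ᶜ = Set.univ :=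
    eq_univ_of_forall fun ξ hξ ↦ hne ξ hξ.2
  have hlt := hf A hA
  rw [huniv, mk_univ, mk_ord_toType] at hlt
  exact lt_irrefl _ hlt
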